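/- Let $P$ be a probability distribution on a measurable space $\mathcal X$ and let $X_1,X_2,\ldots$ be i.i.d. with law $P$. For $n\ge 1$ let $\hat P_n=\frac1n\sum_{i=1}^n\delta_{X_i}$ be the empirical distribution. Fix $B$, the number of resamples; given the data, let $P_n^{*1},\ldots,P_n^{*B}$ be the empirical distributions of $B$ independent resamples, each consisting of $n$ points drawn independently and uniformly with replacement from $\{X_1,\ldots,X_n\}$. Let $\psi$ be a real-valued functional of probability distributions on $\mathcal X$. For a distribution $Q$, a computation run $\hat\psi_r(Q)$ is a real random variable whose law is a measurable function (Markov kernel) of $Q$. For every $Q$ in a class of distributions that contains $P$ and all empirical distributions of finite nonempty samples (for instance, the class of all distributions), the run is integrable and unbiased, $E\hat\psi_r(Q)=\psi(Q)$. Write $\tau^2(Q)=\mathrm{Var}(\hat\psi_r(Q))\in[0,\infty]$ and $\kappa_3(Q)=E|\hat\psi_r(Q)-\psi(Q)|^3\in[0,\infty]$. For positive integers $R_0=R_0(n)$ and $R=R(n)$ put $$\hat{\hat\psi}_{n,R_0}=\frac1{R_0}\sum_{r=1}^{R_0}\hat\psi_r(\hat P_n),\qquad \psi_{n,R}^{**b}=\frac1R\sum_{r=1}^{R}\hat\psi_r(P_n^{*b}),\quad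 b=1,\ldots,B,$$ where, given the data and the resamples, all these computation runs are independent, each with the law of a run driven by the indicated distribution. Write $\psi=\psi(P)$, $\hat\psi_n=\psi(\hat P_n)$, and $P_n^*$, $\psi_n^*=\psi(P_n^*)$ for a generic resample. Assume: 1. (Bootstrap validity) There is $\sigma>0$ such that $\sqrt n(\hat\psi_n-\psi)\Rightarrow N(0,\sigma^2)$, and, for every $x\in\mathbb R$, $P(\sqrt n(\psi_n^*-\hat\psi_n)\le x\mid X_1,\ldots,X_n)\to P(N(0,\sigma^2)\le x)$ in probability as $n\to\infty$. 2. (Moment consistency of the computation runs) $\tau^2:=\tau^2(P)\in(0,\infty)$ and $\kappa_3(P)<\infty$, and as $n\to\infty$ we have, in probability, $\tau^2(\hat P_n)\to\tau^2(P)$, $\kappa_3(\hat P_n)\to\kappa_3(P)$, $\tau^2(P_n^*)\to\tau^2(P)$ and $\kappa_3(P_n^*)\to\kappa_3(P)$. 3. $R_0/n\to p_0$ and $R/n\to p$ as $n\to\infty$, for constants $0<p_0,p<1$. Then, with $\tau=\sqrt{\tau^2}>0$, as $n\to\infty$, jointly in $\mathbb R^{B+1}$, $$\sqrt n\left(\hat{\hat\psi}_{n,R_0}-\psi,\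 \psi_{n,R}^{**1}-\hat{\hat\psi}_{n,R_0},\ldots,\psi_{n,R}^{**B}-\hat{\hat\psi}_{n,R_0}\right)$$ $$\Rightarrow\left(\sigma Z_0+\frac{\tau}{\sqrt{p_0}}W_0,\ \sigma Z_1+\frac{\tau}{\sqrt p}W_1-\frac{\tau}{\sqrt{p_0}}W_0,\ldots,\ \sigma Z_B+\frac{\tau}{\sqrt p}W_B-\frac{\tau}{\sqrt{p_0}}W_0\right),$$ where $Z_0,\ldots,Z_B,W_0,\ldots,W_B$ are independent standard normal random variables. -/

import Mathlib

open MeasureTheory ProbabilityTheory Filter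
open scoped ENNReal NNReal Topology

namespace CheapBootstrap

noncomputable section

/-- The Markov kernel `a ↦ ⨂ᵢ κ i a`: given `a`, the coordinates are independent and the
`i`-th one has law `κ i a`. -/
def prodKernel {α β ι : Type*} [MeasurableSpace α] [MeasurableSpace β] [Fintype ι]
    (κ : ι → Kernel α β) [∀ i, IsMarkovKernel (κ i)] : Kernel α (ι → β) where
  toFun a := Measure.pi fun i => κ i a
  measurable' := by
    refine Measurable.measure_of_isPiSystem_of_isProbabilityMeasure
      generateFrom_pi.symm isPiSystem_pi ?_
    rintro s ⟨t, ht, rfl⟩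
    simp only [Measure.pi_pi]
    exact Finset.measurable_fun_prod _ fun i _ =>
      Kernel.measurable_coe _ (ht i (Set.mem_univ i))

instance {α β ι : Type*} [MeasurableSpace α] [MeasurableSpace β] [Fintype ι]
    (κ : ι → Kernel α β) [∀ i, IsMarkovKernel (κ i)] : IsMarkovKernel (prodKernel κ) :=
  ⟨fun a => inferInstanceAs (IsProbabilityMeasure (Measure.pi fun i => κ i a))⟩

/-- The empirical distribution `(1/n) ∑ᵢ δ_{xᵢ}` of a sample of size `n ≥ 1`. -/
def empirical {𝓧 : Type*} [MeasurableSpace 𝓧] {n : ℕ+} (x : Fin n → 𝓧) :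
    ProbabilityMeasure 𝓧 :=
  ⟨((n : ℕ) : ℝ≥0∞)⁻¹ • ∑ i, Measure.dirac (x i), ⟨by
    simp [ENNReal.inv_mul_cancel (a := ((n : ℕ) : ℝ≥0∞)) (by simp) (by simp)]⟩⟩

lemma measurable_empirical {𝓧 : Type*} [MeasurableSpace 𝓧] (n : ℕ+) :
    Measurable (empirical : (Fin n → 𝓧) → ProbabilityMeasure 𝓧) := by
  refine Measurable.subtype_mk (Measure.measurable_of_measurable_coe _ fun s hs => ?_)
  simp only [Measure.smul_apply, Measure.finsetSum_apply, smul_eq_mul]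
  refine Measurable.const_mul (Finset.measurable_fun_sum _ fun i _ => ?_) _
  exact (Measure.measurable_coe hs).comp (Measure.measurable_dirac.comp (measurable_pi_apply i))

/-- One draw from the empirical distribution of `x`, as a kernel in the sample `x`. -/
def empiricalKernel (𝓧 : Type*) [MeasurableSpace 𝓧] (n : ℕ+) : Kernel (Fin n → 𝓧) 𝓧 where
  toFun x := (empirical x : Measure 𝓧)
  measurable' := measurable_subtype_coe.comp (measurable_empirical n)

instance (𝓧 : Type*) [MeasurableSpace 𝓧] (n : ℕ+) : IsMarkovKernel (empiricalKernel 𝓧 n) :=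
  ⟨fun x => inferInstanceAs (IsProbabilityMeasure (empirical x : Measure 𝓧))⟩

/-- One bootstrap resample: given the data `x`, draw `n` points independently and uniformly with
replacement from `x`, i.e. `n` i.i.d. draws from the empirical distribution. -/
def resampleKernel (𝓧 : Type*) [MeasurableSpace 𝓧] (n : ℕ+) :
    Kernel (Fin n → 𝓧) (Fin n → 𝓧) :=
  prodKernel fun _ => empiricalKernel 𝓧 n

instance (𝓧 : Type*) [MeasurableSpace 𝓧] (n : ℕ+) : IsMarkovKernel (resampleKernel 𝓧 n) :=
  inferInstanceAs (IsMarkovKernel (prodKernel fun _ => empiricalKernel 𝓧 n))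

/-- Given `x`, draw `B` resamples independently. -/
def resamplesKernel (𝓧 : Type*) [MeasurableSpace 𝓧] (n : ℕ+) (B : ℕ) :
    Kernel (Fin n → 𝓧) (Fin B → Fin n → 𝓧) :=
  prodKernel fun _ => resampleKernel 𝓧 n

/-- `R` independent computation runs, each with law `K Q`, where `Q` is the empirical distribution
of the sample `x`. Here `K Q` is the law of one computation run driven by `Q`. -/
def runsKernel {𝓧 : Type*} [MeasurableSpace 𝓧] (K : Kernel (ProbabilityMeasure 𝓧) ℝ)
    [IsMarkovKernel K] (n R : ℕ+) : Kernel (Fin n → 𝓧) (Fin R → ℝ) :=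
  prodKernel fun _ => K.comap empirical (measurable_empirical n)

instance {𝓧 : Type*} [MeasurableSpace 𝓧] (K : Kernel (ProbabilityMeasure 𝓧) ℝ)
    [IsMarkovKernel K] (n R : ℕ+) : IsMarkovKernel (runsKernel K n R) :=
  inferInstanceAs (IsMarkovKernel
    (prodKernel fun _ => K.comap empirical (measurable_empirical n)))

/-- All computation runs, given the data `x` and the resamples `y 0, …, y (B - 1)`: `R₀` runs driven
by the empirical distribution of `x` and, for each `b`, `R` runs driven by the empirical
distribution of `y b`; all of them are (conditionally) independent. -/
def allRunsKernel {𝓧 : Type*} [MeasurableSpace 𝓧] (K : Kernel (ProbabilityMeasure 𝓧) ℝ)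
    [IsMarkovKernel K] (n : ℕ+) (B : ℕ) (R₀ R : ℕ+) :
    Kernel ((Fin n → 𝓧) × (Fin B → Fin n → 𝓧)) ((Fin R₀ → ℝ) × (Fin B → Fin R → ℝ)) :=
  (runsKernel K n R₀).comap Prod.fst measurable_fst ×ₖ
    prodKernel fun b : Fin B => (runsKernel K n R).comap (fun p => p.2 b) (by fun_prop)

/-- The first `n` data points. -/
def sample {Ω 𝓧 : Type*} (X : ℕ → Ω → 𝓧) (n : ℕ+) (ω : Ω) : Fin n → 𝓧 := fun i => X i ω

/-- The sampling scheme. `X` is an i.i.d. sequence from `P`. For the sample size `n`: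
`Y n · b` is the `b`-th bootstrap resample, the `B` resamples being independent given the data;
`V₀ n` are the `R₀ n` computation runs driven by the empirical distribution of the data, and
`V n · b` are the `R n` computation runs driven by the empirical distribution of the `b`-th
resample, all runs being independent given the data and the resamples. -/
structure NestedSampling {Ω 𝓧 : Type*} [MeasurableSpace Ω] [MeasurableSpace 𝓧]
    (μ : Measure Ω) (P : ProbabilityMeasure 𝓧)
    (K : Kernel (ProbabilityMeasure 𝓧) ℝ) [IsMarkovKernel K] (B : ℕ) (R₀ R : ℕ+ → ℕ+)
    (X : ℕ → Ω → 𝓧) (Y : (n : ℕ+) → Ω → Fin B → Fin n → 𝓧)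
    (V₀ : (n : ℕ+) → Ω → Fin (R₀ n) → ℝ) (V : (n : ℕ+) → Ω → Fin B → Fin (R n) → ℝ) :
    Prop where
  indep_data : iIndepFun X μ
  law_data : ∀ i, HasLaw (X i) (P : Measure 𝓧) μ
  resamples : ∀ n, HasCondDistrib (Y n) (sample X n) (resamplesKernel 𝓧 n B) μ
  runs : ∀ n, HasCondDistrib (fun ω => (V₀ n ω, V n ω)) (fun ω => (sample X n ω, Y n ω))
    (allRunsKernel K n B (R₀ n) (R n)) μ

/-- Computation runs driven by a distribution `Q` in the class `𝓓` are unbiased for `ψ Q`. -/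
def UnbiasedRuns {𝓧 : Type*} [MeasurableSpace 𝓧] (K : Kernel (ProbabilityMeasure 𝓧) ℝ)
    (ψ : ProbabilityMeasure 𝓧 → ℝ) (𝓓 : Set (ProbabilityMeasure 𝓧)) : Prop :=
  ∀ Q ∈ 𝓓, Integrable (fun v : ℝ => v) (K Q) ∧ ∫ v, v ∂(K Q) = ψ Q

/-- `τ²(Q)`, the (possibly infinite) variance of a computation run driven by `Q`. -/
def runVariance {𝓧 : Type*} [MeasurableSpace 𝓧] (K : Kernel (ProbabilityMeasure 𝓧) ℝ)
    (Q : ProbabilityMeasure 𝓧) : ℝ≥0∞ :=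
  evariance (fun v : ℝ => v) (K Q)

/-- `κ₃(Q) = E|ψ̂ᵣ(Q) - ψ(Q)|³`, the (possibly infinite) third absolute central moment of a
computation run driven by `Q`. -/
def runThirdMoment {𝓧 : Type*} [MeasurableSpace 𝓧] (K : Kernel (ProbabilityMeasure 𝓧) ℝ)
    (ψ : ProbabilityMeasure 𝓧 → ℝ) (Q : ProbabilityMeasure 𝓧) : ℝ≥0∞ :=
  ∫⁻ v, ‖v - ψ Q‖ₑ ^ 3 ∂(K Q)

/-- `P(√n (ψ(P*ₙ) - ψ(P̂ₙ)) ≤ t | data = x)`: the conditional distribution function of the centered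
and scaled resample estimate, given the data. -/
def bootstrapCDF {𝓧 : Type*} [MeasurableSpace 𝓧] (ψ : ProbabilityMeasure 𝓧 → ℝ) (n : ℕ+)
    (x : Fin n → 𝓧) (t : ℝ) : ℝ :=
  (resampleKernel 𝓧 n x).real {y | √(n : ℝ) * (ψ (empirical y) - ψ (empirical x)) ≤ t}

/-- Standard condition for bootstrap validity: `√n (ψ(P̂ₙ) - ψ(P)) ⇒ N(0, σ²)`, and
`√n (ψ(P*ₙ) - ψ(P̂ₙ)) ⇒ N(0, σ²)` conditionally on the data, in probability. -/
structure BootstrapValid {Ω 𝓧 : Type*} [MeasurableSpace Ω] [MeasurableSpace 𝓧]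
    (μ : Measure Ω) [IsProbabilityMeasure μ] (P : ProbabilityMeasure 𝓧)
    (ψ : ProbabilityMeasure 𝓧 → ℝ) (X : ℕ → Ω → 𝓧) (σ : ℝ) : Prop where
  pos : 0 < σ
  original : TendstoInDistribution
    (fun (n : ℕ+) ω => √(n : ℝ) * (ψ (empirical (sample X n ω)) - ψ P)) atTop
    (fun z : ℝ => z) (fun _ => μ) (gaussianReal 0 (σ ^ 2).toNNReal)
  resample : ∀ t : ℝ, TendstoInMeasure μ
    (fun (n : ℕ+) ω => bootstrapCDF ψ n (sample X n ω) t) atTop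
    (fun _ => (gaussianReal 0 (σ ^ 2).toNNReal).real (Set.Iic t))

/-- Moment consistency of the computation runs, with `τ² = τ²(P) ∈ (0, ∞)` and `κ₃(P) < ∞`. -/
structure MomentConsistent {Ω 𝓧 : Type*} [MeasurableSpace Ω] [MeasurableSpace 𝓧]
    (μ : Measure Ω) (P : ProbabilityMeasure 𝓧) (K : Kernel (ProbabilityMeasure 𝓧) ℝ)
    (ψ : ProbabilityMeasure 𝓧 → ℝ) {B : ℕ} (X : ℕ → Ω → 𝓧)
    (Y : (n : ℕ+) → Ω → Fin B → Fin n → 𝓧) (τ : ℝ) : Prop where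
  pos : 0 < τ
  variance_eq : runVariance K P = ENNReal.ofReal (τ ^ 2)
  thirdMoment_lt_top : runThirdMoment K ψ P < ∞
  variance_data : TendstoInMeasure μ
    (fun (n : ℕ+) ω => runVariance K (empirical (sample X n ω))) atTop
    (fun _ => runVariance K P)
  thirdMoment_data : TendstoInMeasure μ
    (fun (n : ℕ+) ω => runThirdMoment K ψ (empirical (sample X n ω))) atTop
    (fun _ => runThirdMoment K ψ P)
  variance_resample : ∀ b, TendstoInMeasure μ
    (fun (n : ℕ+) ω => runVariance K (empirical (Y n ω b))) atTop
    (fun _ => runVariance K P)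
  thirdMoment_resample : ∀ b, TendstoInMeasure μ
    (fun (n : ℕ+) ω => runThirdMoment K ψ (empirical (Y n ω b))) atTop
    (fun _ => runThirdMoment K ψ P)

/-- The average of finitely many computation runs. -/
def average {R : ℕ+} (v : Fin R → ℝ) : ℝ := (∑ r, v r) / (R : ℝ)

end

end CheapBootstrap

open CheapBootstrap

namespace CheapBootstrap

/-! ### Elementary bounds -/

lemma norm_cexp_mul_I_sub_taylor_two_le (x : ℝ) :
    ‖Complex.exp (x * Complex.I) - (1 + x * Complex.I - (x : ℂ) ^ 2 / 2)‖ ≤ 4 * |x| ^ 3 := by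
  have hx : ‖(x : ℂ) * Complex.I‖ = |x| := by simp
  by_cases h : |x| ≤ 1
  · have := Complex.exp_bound (x := x * Complex.I) (by rwa [hx]) (n := 3) (by norm_num)
    rw [hx] at this
    have e : ∑ m ∈ Finset.range 3, (x * Complex.I) ^ m / (m.factorial : ℂ)
        = 1 + x * Complex.I - (x : ℂ) ^ 2 / 2 := by
      simp [Finset.sum_range_succ, mul_pow, Nat.factorial]
      ring
    rw [e] at this
    refine this.trans ?_
    norm_num [Nat.factorial]
    nlinarith [pow_nonneg (abs_nonneg x) 3]
  · push Not at h
    have h1 : ‖Complex.exp (x * Complex.I) - (1 + x * Complex.I - (x : ℂ) ^ 2 / 2)‖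
        ≤ 1 + (1 + |x| + |x| ^ 2 / 2) := by
      refine (norm_sub_le _ _).trans ?_
      rw [Complex.norm_exp_ofReal_mul_I]
      gcongr
      refine (norm_sub_le _ _).trans ?_
      gcongr
      · refine (norm_add_le _ _).trans ?_
        simp
      · simp
    have h2 : 1 ≤ |x| ^ 3 := one_le_pow₀ h.le
    have h3 : |x| ≤ |x| ^ 3 := le_self_pow₀ h.le (by norm_num)
    have h4 : |x| ^ 2 ≤ |x| ^ 3 := pow_le_pow_right₀ h.le (by norm_num)
    linarith

lemma abs_exp_neg_sub_le {a : ℝ} (ha : 0 ≤ a) : |Real.exp (-a) - (1 - a)| ≤ a ^ 2 := by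
  have h0 := Real.one_sub_le_exp_neg a
  rw [abs_of_nonneg (by linarith)]
  by_cases h : a ≤ 1
  · have := Real.abs_exp_sub_one_sub_id_le (x := -a) (by rwa [abs_neg, abs_of_nonneg ha])
    have := (abs_le.1 this).2
    nlinarith
  · have := Real.exp_le_one_iff.2 (neg_nonpos.2 ha)
    nlinarith

lemma norm_pow_sub_pow_le_of_norm_le_one {z w : ℂ} (hz : ‖z‖ ≤ 1) (hw : ‖w‖ ≤ 1) (n : ℕ) :
    ‖z ^ n - w ^ n‖ ≤ n * ‖z - w‖ := by
  induction n with
  | zero => simp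
  | succ n ih =>
    have e : z ^ (n + 1) - w ^ (n + 1) = z * (z ^ n - w ^ n) + (z - w) * w ^ n := by ring
    rw [e]
    refine (norm_add_le _ _).trans ?_
    rw [norm_mul, norm_mul, norm_pow]
    have h1 : ‖z‖ * ‖z ^ n - w ^ n‖ ≤ 1 * (n * ‖z - w‖) := by gcongr
    have h2 : ‖z - w‖ * ‖w‖ ^ n ≤ ‖z - w‖ * 1 := by
      gcongr; exact pow_le_one₀ (norm_nonneg _) hw
    push_cast
    linarith

/-! ### The characteristic function of a centered law -/

section CenteredCharFun

variable {ν : Measure ℝ}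

/-- The characteristic function at `u` of `v - m`, where `v` has law `ν`. -/
noncomputable def centeredCharFun (ν : Measure ℝ) (m u : ℝ) : ℂ :=
  ∫ v, Complex.exp ((u * (v - m) : ℝ) * Complex.I) ∂ν

lemma charFun_eq_mul_centeredCharFun (m u : ℝ) :
    charFun ν u = Complex.exp ((u * m : ℝ) * Complex.I) * centeredCharFun ν m u := by
  rw [charFun_apply_real, centeredCharFun, ← integral_const_mul]
  congr with v
  rw [← Complex.exp_add]
  congr 1
  push_cast
  ring

variable [IsProbabilityMeasure ν]

lemma norm_centeredCharFun_le_one (m u : ℝ) : ‖centeredCharFun ν m u‖ ≤ 1 := by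
  refine (norm_integral_le_of_norm_le_const (C := 1) (ae_of_all _ fun v => ?_)).trans_eq (by simp)
  rw [Complex.norm_exp_ofReal_mul_I]

lemma norm_centeredCharFun_sub_le {m : ℝ} (hint : Integrable (fun v : ℝ => v) ν)
    (hm : ∫ v, v ∂ν = m) (hκ : ∫⁻ v, ‖v - m‖ₑ ^ 3 ∂ν ≠ ∞) (u : ℝ) :
    ‖centeredCharFun ν m u - (1 - u ^ 2 * (evariance (fun v : ℝ => v) ν).toReal / 2 : ℝ)‖
      ≤ 4 * |u| ^ 3 * (∫⁻ v, ‖v - m‖ₑ ^ 3 ∂ν).toReal := by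
  have e3 : ∀ v : ℝ, ‖v - m‖ₑ ^ 3 = ENNReal.ofReal (|v - m| ^ 3) := fun v => by
    rw [Real.enorm_eq_ofReal_abs, ENNReal.ofReal_pow (abs_nonneg _)]
  have e2 : ∀ v : ℝ, ‖v - m‖ₑ ^ 2 = ENNReal.ofReal ((v - m) ^ 2) := fun v => by
    rw [Real.enorm_eq_ofReal_abs, ← ENNReal.ofReal_pow (abs_nonneg _), sq_abs]
  have i3 : Integrable (fun v => |v - m| ^ 3) ν := by
    refine ⟨by fun_prop, ?_⟩
    rw [hasFiniteIntegral_iff_ofReal (ae_of_all _ fun v => by positivity)]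
    simp_rw [← e3]
    exact hκ.lt_top
  have i2 : Integrable (fun v => (v - m) ^ 2) ν := by
    refine ((integrable_const (1 : ℝ)).add i3).mono' (by fun_prop) (ae_of_all _ fun v => ?_)
    rw [Real.norm_eq_abs, abs_of_nonneg (sq_nonneg _), ← sq_abs, Pi.add_apply]
    by_cases h : |v - m| ≤ 1
    · have := pow_le_one₀ (n := 2) (abs_nonneg (v - m)) h
      have := pow_nonneg (abs_nonneg (v - m)) 3
      linarith
    · have := pow_le_pow_right₀ (not_le.1 h).le (show 2 ≤ 3 by norm_num)
      linarith
  have i1 : Integrable (fun v => v - m) ν := hint.sub (integrable_const m)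
  have v3 : (∫⁻ v, ‖v - m‖ₑ ^ 3 ∂ν).toReal = ∫ v, |v - m| ^ 3 ∂ν := by
    simp_rw [e3]
    rw [integral_eq_lintegral_of_nonneg_ae (ae_of_all _ fun v => by positivity) (by fun_prop)]
  have v2 : (evariance (fun v : ℝ => v) ν).toReal = ∫ v, (v - m) ^ 2 ∂ν := by
    rw [evariance, hm]
    simp_rw [e2]
    rw [integral_eq_lintegral_of_nonneg_ae (ae_of_all _ fun v => by positivity) (by fun_prop)]
  have v1 : ∫ v, (v - m) ∂ν = 0 := by
    rw [integral_sub hint (integrable_const m), hm]; simp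
  rw [v2, v3]
  have j0 : Integrable (fun v : ℝ => Complex.exp ((u * (v - m) : ℝ) * Complex.I)) ν := by
    refine (integrable_const (1 : ℝ)).mono' (by fun_prop) (ae_of_all _ fun v => ?_)
    rw [Complex.norm_exp_ofReal_mul_I]
  have j1 : Integrable (fun v : ℝ => ((u * (v - m) : ℝ) : ℂ) * Complex.I) ν :=
    (i1.const_mul u).ofReal.mul_const _
  have j2 : Integrable (fun v : ℝ => ((u * (v - m) : ℝ) : ℂ) ^ 2 / 2) ν := by
    have : Integrable (fun v : ℝ => ((u ^ 2 * (v - m) ^ 2 : ℝ) : ℂ)) ν :=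
      (i2.const_mul (u ^ 2)).ofReal
    refine (this.div_const 2).congr (ae_of_all _ fun v => ?_)
    push_cast; ring
  have key : centeredCharFun ν m u - (1 - u ^ 2 * (∫ v, (v - m) ^ 2 ∂ν) / 2 : ℝ) =
      ∫ v, (Complex.exp ((u * (v - m) : ℝ) * Complex.I) - (1 + (u * (v - m) : ℝ) * Complex.I
        - ((u * (v - m) : ℝ) : ℂ) ^ 2 / 2)) ∂ν := by
    have j3 : Integrable (fun v : ℝ => 1 + ((u * (v - m) : ℝ) : ℂ) * Complex.I) ν :=
      (integrable_const _).add j1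
    have j4 : Integrable (fun v : ℝ => 1 + ((u * (v - m) : ℝ) : ℂ) * Complex.I
        - ((u * (v - m) : ℝ) : ℂ) ^ 2 / 2) ν := j3.sub j2
    rw [integral_sub j0 j4, integral_sub j3 j2, integral_add (integrable_const _) j1,
      integral_mul_const, integral_div]
    have a1 : ∫ v, ((u * (v - m) : ℝ) : ℂ) ∂ν = 0 := by
      rw [integral_complex_ofReal, integral_const_mul, v1]; simp
    have a2 : ∫ v, ((u * (v - m) : ℝ) : ℂ) ^ 2 ∂ν = ((u ^ 2 * ∫ v, (v - m) ^ 2 ∂ν : ℝ) : ℂ) := by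
      rw [← integral_const_mul, ← integral_complex_ofReal]
      congr with v
      push_cast; ring
    rw [a1, a2, centeredCharFun]
    simp
  rw [key]
  calc _ ≤ ∫ v, 4 * |u| ^ 3 * |v - m| ^ 3 ∂ν := by
        refine norm_integral_le_of_norm_le (i3.const_mul _) (ae_of_all _ fun v => ?_)
        refine (norm_cexp_mul_I_sub_taylor_two_le _).trans_eq ?_
        rw [abs_mul]; ring
    _ = _ := by rw [integral_const_mul]

lemma norm_centeredCharFun_pow_sub_le {m : ℝ} (hint : Integrable (fun v : ℝ => v) ν)
    (hm : ∫ v, v ∂ν = m) (hκ : ∫⁻ v, ‖v - m‖ₑ ^ 3 ∂ν ≠ ∞) (u : ℝ) (R : ℕ) :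
    ‖centeredCharFun ν m u ^ R
        - (Real.exp (-(R * u ^ 2 * (evariance (fun v : ℝ => v) ν).toReal / 2)) : ℝ)‖
      ≤ R * (4 * |u| ^ 3 * (∫⁻ v, ‖v - m‖ₑ ^ 3 ∂ν).toReal
        + (u ^ 2 * (evariance (fun v : ℝ => v) ν).toReal / 2) ^ 2) := by
  set V := (evariance (fun v : ℝ => v) ν).toReal with hV
  have hV0 : 0 ≤ V := ENNReal.toReal_nonneg
  set a : ℝ := u ^ 2 * V / 2
  have ha : 0 ≤ a := by positivity
  have e : (Real.exp (-(R * u ^ 2 * V / 2)) : ℝ) = ((Real.exp (-a) : ℝ) : ℂ) ^ R := by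
    rw [← Complex.ofReal_pow, ← Real.exp_nat_mul]
    congr 2
    simp only [a]; ring
  rw [e]
  refine (norm_pow_sub_pow_le_of_norm_le_one (norm_centeredCharFun_le_one m u) ?_ R).trans ?_
  · rw [Complex.norm_real, Real.norm_eq_abs, Real.abs_exp]
    exact Real.exp_le_one_iff.2 (neg_nonpos.2 ha)
  gcongr
  have h1 := norm_centeredCharFun_sub_le hint hm hκ u
  have h2 := abs_exp_neg_sub_le ha
  rw [abs_sub_comm, ← Real.norm_eq_abs, ← Complex.norm_real] at h2
  have := norm_add_le_of_le h1 h2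
  refine le_trans (le_of_eq ?_) this
  congr 1
  push_cast
  simp only [a]
  push_cast
  ring

end CenteredCharFun

/-! ### Convergence in probability as a filter -/

section InProbability

variable {Ω ι E : Type*} [MeasurableSpace Ω]

/-- A family `A` converges in probability to the constant `a` along `l` iff it tends to `a` along
this filter. -/
def inProbability (μ : Measure Ω) (l : Filter ι) : Filter (ι × Ω) where
  sets := {S | Tendsto (fun i => μ {ω | (i, ω) ∉ S}) l (𝓝 0)}
  univ_sets := by simpa using tendsto_const_nhds
  sets_of_superset {S T} hS hST := by
    refine tendsto_of_tendsto_of_tendsto_of_le_of_le tendsto_const_nhds hS (fun _ => zero_le) ?_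
    intro i
    exact measure_mono fun ω hω h => hω (hST h)
  inter_sets {S T} hS hT := by
    have h : Tendsto (fun i => μ {ω | (i, ω) ∉ S} + μ {ω | (i, ω) ∉ T}) l (𝓝 0) := by
      simpa using Tendsto.add hS hT
    refine tendsto_of_tendsto_of_tendsto_of_le_of_le tendsto_const_nhds h (fun _ => zero_le) ?_
    intro i
    refine (measure_mono fun ω hω => ?_).trans (measure_union_le _ _)
    by_cases h : (i, ω) ∈ S
    · exact Or.inr fun h' => hω ⟨h, h'⟩
    · exact Or.inl h

lemma mem_inProbability {μ : Measure Ω} {l : Filter ι} {S : Set (ι × Ω)} :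
    S ∈ inProbability μ l ↔ Tendsto (fun i => μ {ω | (i, ω) ∉ S}) l (𝓝 0) := Iff.rfl

lemma tendsto_fst_inProbability (μ : Measure Ω) (l : Filter ι) :
    Tendsto Prod.fst (inProbability μ l) l := by
  intro S hS
  refine tendsto_const_nhds.congr' ?_
  filter_upwards [hS] with i hi
  simp [hi]

lemma _root_.MeasureTheory.TendstoInMeasure.tendsto_inProbability [PseudoEMetricSpace E]
    {μ : Measure Ω} {l : Filter ι} {A : ι → Ω → E} {a : E}
    (h : TendstoInMeasure μ A l fun _ => a) :
    Tendsto (fun q : ι × Ω => A q.1 q.2) (inProbability μ l) (𝓝 a) := by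
  intro U hU
  obtain ⟨ε, hε, hU⟩ := EMetric.mem_nhds_iff.1 hU
  refine tendsto_of_tendsto_of_tendsto_of_le_of_le tendsto_const_nhds (h ε hε)
    (fun _ => zero_le) fun i => measure_mono fun ω hω => ?_
  by_contra hlt
  exact hω (hU (Metric.mem_eball.2 (not_le.1 hlt)))

lemma _root_.MeasureTheory.TendstoInMeasure.tendsto_inProbability_ennreal
    {μ : Measure Ω} {l : Filter ι} {A : ι → Ω → ℝ≥0∞} {a : ℝ≥0∞} (ha : a ≠ ∞)
    (h : TendstoInMeasure μ A l fun _ => a) :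
    Tendsto (fun q : ι × Ω => A q.1 q.2) (inProbability μ l) (𝓝 a) := by
  lift a to ℝ≥0 using ha
  intro U hU
  rw [ENNReal.nhds_coe, mem_map] at hU
  obtain ⟨ε, hε, hU⟩ := EMetric.mem_nhds_iff.1 hU
  refine tendsto_of_tendsto_of_tendsto_of_le_of_le tendsto_const_nhds (h ε hε)
    (fun _ => zero_le) fun i => measure_mono fun ω hω => ?_
  by_contra hlt
  have hlt : edist (A i ω) a < ε := not_le.1 hlt
  have hfin : A i ω ≠ ∞ := by
    intro htop
    rw [(ENNReal.edist_eq_top_iff _ _).2 ⟨by simp [htop], Or.inl htop⟩] at hlt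
    exact not_top_lt hlt
  apply hω
  change A i ω ∈ U
  lift A i ω to ℝ≥0 using hfin with b
  exact hU (show edist b a < ε from hlt)

/-- Bounded convergence in probability. -/
lemma tendsto_integral_mul_sub_of_inProbability {μ : Measure Ω} [IsProbabilityMeasure μ]
    {l : Filter ι} {Φ G : ι → Ω → ℂ} {c : ℂ} (hΦm : ∀ i, AEStronglyMeasurable (Φ i) μ)
    (hGm : ∀ i, AEStronglyMeasurable (G i) μ) (hΦ : ∀ i ω, ‖Φ i ω‖ ≤ 1)
    (hG : ∀ i ω, ‖G i ω‖ ≤ 1) (hc : ‖c‖ ≤ 1)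
    (h : Tendsto (fun q : ι × Ω => Φ q.1 q.2) (inProbability μ l) (𝓝 c)) :
    Tendsto (fun i => ∫ ω, G i ω * Φ i ω ∂μ - c * ∫ ω, G i ω ∂μ) l (𝓝 0) := by
  have iG : ∀ i, Integrable (G i) μ := fun i =>
    (integrable_const (1 : ℝ)).mono' (hGm i) (ae_of_all _ (hG i))
  have iD : ∀ i, Integrable (fun ω => ‖Φ i ω - c‖) μ := fun i => by
    refine (integrable_const (2 : ℝ)).mono' ((hΦm i).sub aestronglyMeasurable_const).norm
      (ae_of_all _ fun ω => ?_)
    rw [norm_norm]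
    linarith [norm_sub_le (Φ i ω) c, hΦ i ω]
  have iGΦ : ∀ i, Integrable (fun ω => G i ω * Φ i ω) μ := fun i => by
    refine (integrable_const (1 : ℝ)).mono' ((hGm i).mul (hΦm i)) (ae_of_all _ fun ω => ?_)
    rw [norm_mul]
    exact mul_le_one₀ (hG i ω) (norm_nonneg _) (hΦ i ω)
  rw [Metric.tendsto_nhds]
  intro ε hε
  have hS : {q : ι × Ω | ‖Φ q.1 q.2 - c‖ < ε / 2} ∈ inProbability μ l := by
    have := (Metric.tendsto_nhds.1 h) (ε / 2) (by positivity)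
    simp_rw [dist_eq_norm] at this
    exact this
  have hS' := (ENNReal.tendsto_toReal (by simp)).comp (mem_inProbability.1 hS)
  filter_upwards [(Metric.tendsto_nhds.1 hS') (ε / 8) (by positivity)] with i hi
  have hi' : μ.real {ω | ε / 2 ≤ ‖Φ i ω - c‖} < ε / 8 := by
    simpa [abs_of_nonneg, measureReal_def] using hi
  rw [dist_zero_right, ← integral_const_mul, ← integral_sub (iGΦ i) ((iG i).const_mul c)]
  set D := {ω | ε / 2 ≤ ‖Φ i ω - c‖}
  have hD : NullMeasurableSet D μ :=
    nullMeasurableSet_le aemeasurable_const (iD i).aemeasurable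
  have iI : Integrable (D.indicator fun _ => (2 : ℝ)) μ := (integrable_const _).indicator₀ hD
  calc _ ≤ ∫ ω, (ε / 2 + D.indicator (fun _ => (2 : ℝ)) ω) ∂μ := by
        refine norm_integral_le_of_norm_le ((integrable_const _).add iI) (ae_of_all _ fun ω => ?_)
        have e : G i ω * Φ i ω - c * G i ω = G i ω * (Φ i ω - c) := by ring
        rw [e, norm_mul]
        have h1 : ‖G i ω‖ * ‖Φ i ω - c‖ ≤ ‖Φ i ω - c‖ :=
          mul_le_of_le_one_left (norm_nonneg _) (hG i ω)
        by_cases hω : ω ∈ D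
        · rw [Set.indicator_of_mem hω]
          linarith [norm_sub_le (Φ i ω) c, hΦ i ω]
        · rw [Set.indicator_of_notMem hω]
          have : ‖Φ i ω - c‖ < ε / 2 := not_le.1 hω
          linarith
    _ = ε / 2 + 2 * μ.real D := by
        rw [integral_add (integrable_const _) iI, integral_indicator₀ hD]
        simp [mul_comm]
    _ < ε := by linarith

end InProbability

/-! ### Distribution functions control characteristic functions -/

lemma tendsto_of_tendsto_real_Iic {ν : ℕ → ProbabilityMeasure ℝ} {γ : ProbabilityMeasure ℝ}
    (h : ∀ q : ℚ, Tendsto (fun k => (ν k : Measure ℝ).real (Set.Iic (q : ℝ))) atTop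
      (𝓝 ((γ : Measure ℝ).real (Set.Iic (q : ℝ))))) : Tendsto ν atTop (𝓝 γ) := by
  have hIoc : ∀ (ρ : ProbabilityMeasure ℝ) (a b : ℝ), a ≤ b →
      ((ρ (Set.Ioc a b) : ℝ≥0) : ℝ)
        = (ρ : Measure ℝ).real (Set.Iic b) - (ρ : Measure ℝ).real (Set.Iic a) := by
    intro ρ a b hab
    rw [← measureReal_sdiff (Set.Iic_subset_Iic.2 hab) measurableSet_Iic, Set.Iic_sdiff_Iic]
    rfl
  refine IsPiSystem.tendsto_probabilityMeasure_of_tendsto_of_mem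
    (S := {s | ∃ a b : ℚ, a ≤ b ∧ s = Set.Ioc (a : ℝ) b}) ?_ ?_ ?_ ?_
  · rintro _ ⟨a, b, hab, rfl⟩ _ ⟨c, d, hcd, rfl⟩ hne
    rw [Set.Ioc_inter_Ioc] at hne ⊢
    refine ⟨max a c, min b d, ?_, by push_cast; rfl⟩
    have := (Set.nonempty_Ioc.1 hne).le
    exact_mod_cast this
  · rintro _ ⟨a, b, -, rfl⟩
    exact measurableSet_Ioc
  · intro u hu x hx
    obtain ⟨l, r, ⟨hl, hr⟩, hlr⟩ := mem_nhds_iff_exists_Ioo_subset.1 (hu.mem_nhds hx)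
    obtain ⟨a, ha, ha'⟩ := exists_rat_btwn hl
    obtain ⟨b, hb, hb'⟩ := exists_rat_btwn hr
    refine ⟨_, ⟨a, b, by exact_mod_cast (ha'.trans hb).le, rfl⟩, Ioc_mem_nhds ha' hb, ?_⟩
    exact fun y hy => hlr ⟨ha.trans hy.1, hy.2.trans_lt hb'⟩
  · rintro _ ⟨a, b, hab, rfl⟩
    rw [← NNReal.tendsto_coe]
    simp_rw [hIoc _ (a : ℝ) b (by exact_mod_cast hab)]
    exact (h b).sub (h a)

lemma exists_finset_forall_norm_charFun_sub_lt (γ : ProbabilityMeasure ℝ) (t : ℝ) {ε : ℝ}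
    (hε : 0 < ε) : ∃ (s : Finset ℚ) (δ : ℝ), 0 < δ ∧ ∀ ν : ProbabilityMeasure ℝ,
      (∀ q ∈ s, |(ν : Measure ℝ).real (Set.Iic (q : ℝ))
        - (γ : Measure ℝ).real (Set.Iic (q : ℝ))| < δ) →
      ‖charFun (ν : Measure ℝ) t - charFun (γ : Measure ℝ) t‖ < ε := by
  classical
  by_contra! hcon
  obtain ⟨e, he⟩ := exists_surjective_nat ℚ
  choose ν hν hν' using fun k : ℕ => hcon ((Finset.range k).image e) (1 / ((k : ℝ) + 1))
    (by positivity)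
  have hlim : Tendsto ν atTop (𝓝 γ) := by
    refine tendsto_of_tendsto_real_Iic fun q => ?_
    obtain ⟨j, rfl⟩ := he q
    rw [tendsto_iff_dist_tendsto_zero]
    refine squeeze_zero' (Eventually.of_forall fun _ => dist_nonneg) ?_
      (tendsto_one_div_add_atTop_nhds_zero_nat (𝕜 := ℝ))
    filter_upwards [eventually_gt_atTop j] with k hk
    exact (hν k _ (Finset.mem_image_of_mem _ (Finset.mem_range.2 hk))).le
  have := ProbabilityMeasure.tendsto_iff_tendsto_charFun.1 hlim t
  obtain ⟨k, hk⟩ := ((Metric.tendsto_nhds.1 this) ε hε).exists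
  rw [dist_eq_norm] at hk
  exact absurd hk (not_lt.2 (hν' k))

lemma tendsto_charFun_of_tendsto_real_Iic {α : Type*} {l : Filter α}
    {ν : α → ProbabilityMeasure ℝ} {γ : ProbabilityMeasure ℝ}
    (h : ∀ x : ℝ, Tendsto (fun k => (ν k : Measure ℝ).real (Set.Iic x)) l
      (𝓝 ((γ : Measure ℝ).real (Set.Iic x)))) (t : ℝ) :
    Tendsto (fun k => charFun (ν k : Measure ℝ) t) l (𝓝 (charFun (γ : Measure ℝ) t)) := by
  rw [Metric.tendsto_nhds]
  intro ε hε
  obtain ⟨s, δ, hδ, hs⟩ := exists_finset_forall_norm_charFun_sub_lt γ t hε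
  have : ∀ᶠ k in l, ∀ q ∈ s, |(ν k : Measure ℝ).real (Set.Iic (q : ℝ))
        - (γ : Measure ℝ).real (Set.Iic (q : ℝ))| < δ :=
    (Finset.eventually_all s).2 fun q _ => (Metric.tendsto_nhds.1 (h q)) δ hδ
  filter_upwards [this] with k hk
  rw [dist_eq_norm]
  exact hs _ hk

/-! ### Convergence in distribution through characteristic functions -/

section Levy

variable {Ω Ω' ι : Type*} [MeasurableSpace Ω] [MeasurableSpace Ω'] [Fintype ι]

lemma charFun_map_toLp {μ : Measure Ω} {X : Ω → ι → ℝ} (hX : AEMeasurable X μ)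
    (t : EuclideanSpace ℝ ι) :
    charFun (μ.map fun ω => WithLp.toLp 2 (X ω)) t
      = ∫ ω, Complex.exp ((∑ i, t i * X ω i : ℝ) * Complex.I) ∂μ := by
  rw [charFun_apply, integral_map (by fun_prop) (by fun_prop)]
  simp [PiLp.inner_apply]

lemma tendstoInDistribution_of_tendsto_charFun {μ : Measure Ω} [IsProbabilityMeasure μ]
    {μ' : Measure Ω'} [IsProbabilityMeasure μ'] {X : ℕ+ → Ω → ι → ℝ} {Z : Ω' → ι → ℝ}
    (hX : ∀ n, AEMeasurable (X n) μ) (hZ : AEMeasurable Z μ')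
    (h : ∀ t : ι → ℝ, Tendsto
      (fun n => ∫ ω, Complex.exp ((∑ i, t i * X n ω i : ℝ) * Complex.I) ∂μ) atTop
      (𝓝 (∫ ω, Complex.exp ((∑ i, t i * Z ω i : ℝ) * Complex.I) ∂μ'))) :
    TendstoInDistribution X atTop Z (fun _ => μ) μ' := by
  have hX' : ∀ n, AEMeasurable (fun ω => WithLp.toLp 2 (X n ω) : Ω → EuclideanSpace ℝ ι) μ :=
    fun n => by fun_prop
  have key : TendstoInDistribution
      (fun n ω => (WithLp.toLp 2 (X n ω) : EuclideanSpace ℝ ι)) atTop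
      (fun ω => (WithLp.toLp 2 (Z ω) : EuclideanSpace ℝ ι)) (fun _ => μ) μ' := by
    refine ⟨hX', by fun_prop, ?_⟩
    have hmap : (atTop : Filter ℕ+) = map OrderIso.pnatIsoNat.symm atTop :=
      (OrderIso.map_atTop _).symm
    rw [hmap]
    refine tendsto_map'_iff.2 ?_
    refine ProbabilityMeasure.tendsto_of_tendsto_charFun fun t => ?_
    change Tendsto (fun k => charFun (μ.map fun ω =>
      (WithLp.toLp 2 (X (OrderIso.pnatIsoNat.symm k) ω) : EuclideanSpace ℝ ι)) t) atTop
      (𝓝 (charFun (μ'.map fun ω => (WithLp.toLp 2 (Z ω) : EuclideanSpace ℝ ι)) t))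
    rw [charFun_map_toLp hZ]
    simp_rw [charFun_map_toLp (hX _)]
    have := h t
    rw [hmap, tendsto_map'_iff] at this
    exact this
  exact key.continuous_comp (PiLp.continuous_ofLp 2 fun _ : ι => ℝ)

lemma _root_.MeasureTheory.TendstoInDistribution.tendsto_integral_cexp {κ : Type*} {l : Filter κ}
    {μ : Measure Ω} [IsProbabilityMeasure μ] {γ : Measure ℝ} [IsProbabilityMeasure γ]
    {X : κ → Ω → ℝ} (h : TendstoInDistribution X l (fun z : ℝ => z) (fun _ => μ) γ) (t : ℝ) :
    Tendsto (fun n => ∫ ω, Complex.exp ((t * X n ω : ℝ) * Complex.I) ∂μ) l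
      (𝓝 (charFun γ t)) := by
  have h' := (ProbabilityMeasure.tendsto_iff_forall_integral_rclike_tendsto ℂ).1 h.tendsto
    (BoundedContinuousFunction.innerProbChar t)
  simp only [ProbabilityMeasure.coe_mk, ← charFun_eq_integral_innerProbChar, Measure.map_id'] at h'
  refine h'.congr fun n => ?_
  rw [charFun_apply_real, integral_map (h.forall_aemeasurable n) (by fun_prop)]
  simp

end Levy

/-! ### Powers of centered characteristic functions -/

lemma tendsto_centeredCharFun_pow {α : Type*} {l : Filter α} {ν : α → Measure ℝ}
    [∀ a, IsProbabilityMeasure (ν a)] {m : α → ℝ}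
    (hint : ∀ a, Integrable (fun v : ℝ => v) (ν a)) (hm : ∀ a, ∫ v, v ∂(ν a) = m a)
    {τ : ℝ} {k : ℝ≥0∞} (hk : k ≠ ∞)
    (hτ : Tendsto (fun a => evariance (fun v : ℝ => v) (ν a)) l (𝓝 (ENNReal.ofReal (τ ^ 2))))
    (hκ : Tendsto (fun a => ∫⁻ v, ‖v - m a‖ₑ ^ 3 ∂(ν a)) l (𝓝 k))
    {N R : α → ℕ+} {p : ℝ} (hp : 0 < p) (hN : Tendsto (fun a => (N a : ℝ)) l atTop)
    (hR : Tendsto (fun a => (R a : ℝ) / (N a : ℝ)) l (𝓝 p)) (s : ℝ) :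
    Tendsto (fun a => centeredCharFun (ν a) (m a) (s * √(N a : ℝ) / (R a : ℝ)) ^ (R a : ℕ)) l
      (𝓝 (charFun (gaussianReal 0 1) (τ / √p * s))) := by
  have hV : Tendsto (fun a => (evariance (fun v : ℝ => v) (ν a)).toReal) l (𝓝 (τ ^ 2)) := by
    have := (ENNReal.tendsto_toReal ENNReal.ofReal_ne_top).comp hτ
    rwa [ENNReal.toReal_ofReal (sq_nonneg _)] at this
  have hK : Tendsto (fun a => (∫⁻ v, ‖v - m a‖ₑ ^ 3 ∂(ν a)).toReal) l (𝓝 k.toReal) :=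
    (ENNReal.tendsto_toReal hk).comp hκ
  have hfin : ∀ᶠ a in l, ∫⁻ v, ‖v - m a‖ₑ ^ 3 ∂(ν a) ≠ ∞ :=
    (hκ.eventually_lt_const hk.lt_top).mono fun _ h => h.ne
  set u : α → ℝ := fun a => s * √(N a : ℝ) / (R a : ℝ) with hu_def
  have hpos : ∀ n : ℕ+, (0 : ℝ) < n := fun n => by exact_mod_cast n.pos
  have hinv : Tendsto (fun a => ((R a : ℝ) / (N a : ℝ))⁻¹) l (𝓝 p⁻¹) := hR.inv₀ hp.ne'
  have hsq : Tendsto (fun a => (√(N a : ℝ))⁻¹) l (𝓝 0) :=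
    tendsto_inv_atTop_zero.comp (Real.tendsto_sqrt_atTop.comp hN)
  have hu : Tendsto u l (𝓝 0) := by
    have := (hinv.mul hsq).const_mul s
    simp only [mul_zero] at this
    refine this.congr fun a => ?_
    have h1 := hpos (N a)
    have h2 := hpos (R a)
    have h3 : √(N a : ℝ) ≠ 0 := (Real.sqrt_pos.2 h1).ne'
    have h4 : (N a : ℝ) = √(N a : ℝ) ^ 2 := (Real.sq_sqrt h1.le).symm
    simp only [hu_def]
    field_simp
    rw [← h4]
  have hRu : Tendsto (fun a => (R a : ℝ) * u a ^ 2) l (𝓝 (s ^ 2 * p⁻¹)) := by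
    refine (hinv.const_mul (s ^ 2)).congr fun a => ?_
    have h1 := hpos (N a)
    have h2 := hpos (R a)
    simp only [hu_def, div_pow, mul_pow, Real.sq_sqrt h1.le]
    field_simp
  have hlim : charFun (gaussianReal 0 1) (τ / √p * s)
      = (Real.exp (-(s ^ 2 * p⁻¹ * τ ^ 2 / 2)) : ℝ) := by
    rw [charFun_gaussianReal, Complex.ofReal_exp]
    congr 1
    have : (τ / √p * s) ^ 2 = s ^ 2 * p⁻¹ * τ ^ 2 := by
      rw [mul_pow, div_pow, Real.sq_sqrt hp.le]
      field_simp
    have h' : ((τ / √p * s : ℝ) : ℂ) ^ 2 = ((s ^ 2 * p⁻¹ * τ ^ 2 : ℝ) : ℂ) := by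
      rw [← this]; push_cast; rfl
    rw [h']
    push_cast
    simp
  have hexp : Tendsto (fun a => ((Real.exp (-((R a : ℝ) * u a ^ 2
      * (evariance (fun v : ℝ => v) (ν a)).toReal / 2)) : ℝ) : ℂ)) l
      (𝓝 (charFun (gaussianReal 0 1) (τ / √p * s))) := by
    rw [hlim]
    exact (Complex.continuous_ofReal.tendsto _).comp ((Real.continuous_exp.tendsto _).comp
      (((hRu.mul hV).div_const 2).neg))
  have hbound : Tendsto (fun a => (R a : ℝ) * (4 * |u a| ^ 3
        * (∫⁻ v, ‖v - m a‖ₑ ^ 3 ∂(ν a)).toReal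
      + (u a ^ 2 * (evariance (fun v : ℝ => v) (ν a)).toReal / 2) ^ 2)) l (𝓝 0) := by
    have h1 := ((hRu.mul hu.abs).mul hK).const_mul 4
    have h2 := ((hRu.mul (hu.pow 2)).mul (hV.pow 2)).div_const 4
    have h3 := h1.add h2
    simp only [abs_zero, mul_zero, zero_mul, add_zero, ne_eq, OfNat.ofNat_ne_zero,
      not_false_eq_true, zero_pow, zero_div] at h3
    refine h3.congr fun a => ?_
    have : |u a| ^ 3 = u a ^ 2 * |u a| := by rw [pow_succ, sq_abs]
    rw [this]; ring
  have hdiff : Tendsto (fun a => centeredCharFun (ν a) (m a) (u a) ^ (R a : ℕ)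
      - ((Real.exp (-((R a : ℝ) * u a ^ 2
      * (evariance (fun v : ℝ => v) (ν a)).toReal / 2)) : ℝ) : ℂ)) l (𝓝 0) := by
    refine squeeze_zero_norm' ?_ hbound
    filter_upwards [hfin] with a ha
    exact norm_centeredCharFun_pow_sub_le (hint a) (hm a) ha (u a) (R a)
  simpa using hdiff.add hexp

/-! ### Integrals against the sampling kernels -/

section Sampling

lemma _root_.ProbabilityTheory.HasCondDistrib.integral_eq {Ω α β : Type*} [MeasurableSpace Ω]
    [MeasurableSpace α] [MeasurableSpace β] {μ : Measure Ω} [IsProbabilityMeasure μ] {X : Ω → α}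
    {Y : Ω → β} {κ : Kernel α β} [IsMarkovKernel κ] (h : HasCondDistrib Y X κ μ)
    {f : α × β → ℂ} (hf : Measurable f) (hb : ∀ z, ‖f z‖ ≤ 1) :
    ∫ ω, f (X ω, Y ω) ∂μ = ∫ ω, ∫ b, f (X ω, b) ∂κ (X ω) ∂μ := by
  have hX : AEMeasurable X μ := h.aemeasurable_fst
  have := Measure.isProbabilityMeasure_map hX
  have hi : Integrable f (μ.map X ⊗ₘ κ) :=
    (integrable_const (1 : ℝ)).mono' hf.aestronglyMeasurable (ae_of_all _ hb)
  have h1 : ∫ ω, f (X ω, Y ω) ∂μ = ∫ z, f z ∂(μ.map X ⊗ₘ κ) :=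
    HasLaw.integral_comp h hf.aestronglyMeasurable
  rw [h1, Measure.integral_compProd hi,
    integral_map hX hf.stronglyMeasurable.integral_kernel_prod_right'.aestronglyMeasurable]

lemma integral_cexp_average_pi (ν : Measure ℝ) [IsProbabilityMeasure ν] (R : ℕ+) (s : ℝ) :
    ∫ v : Fin R → ℝ, Complex.exp ((s * average v : ℝ) * Complex.I) ∂Measure.pi (fun _ => ν)
      = charFun ν (s / (R : ℝ)) ^ (R : ℕ) := by
  have e : ∀ v : Fin R → ℝ, Complex.exp ((s * average v : ℝ) * Complex.I)
      = ∏ r, Complex.exp (((s / (R : ℝ) : ℝ) : ℂ) * (v r : ℂ) * Complex.I) := fun v => by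
    rw [← Complex.exp_sum]
    congr 1
    rw [← Finset.sum_mul, ← Finset.mul_sum, average]
    push_cast
    ring
  simp_rw [e]
  rw [integral_fintype_prod_eq_prod
    (f := fun (_ : Fin R) (x : ℝ) => Complex.exp (((s / (R : ℝ) : ℝ) : ℂ) * x * Complex.I)),
    Finset.prod_const, charFun_apply_real]
  simp

variable {𝓧 : Type*} [MeasurableSpace 𝓧] {K : Kernel (ProbabilityMeasure 𝓧) ℝ}
  {ψ : ProbabilityMeasure 𝓧 → ℝ} {𝓓 : Set (ProbabilityMeasure 𝓧)}

lemma UnbiasedRuns.measurable_comp_empirical (hK : UnbiasedRuns K ψ 𝓓) {n : ℕ+}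
    (hemp : ∀ x : Fin n → 𝓧, empirical x ∈ 𝓓) :
    Measurable fun x : Fin n → 𝓧 => ψ (empirical x) := by
  have e : (fun x : Fin n → 𝓧 => ψ (empirical x))
      = fun x => ∫ v, v ∂(K.comap empirical (measurable_empirical n) x) := by
    ext x
    exact (hK _ (hemp x)).2.symm
  rw [e]
  exact (StronglyMeasurable.integral_kernel (f := fun v : ℝ => v)
    measurable_id.stronglyMeasurable).measurable

lemma measurable_charFun_empirical (n : ℕ+) (u : ℝ) :
    Measurable fun x : Fin n → 𝓧 => charFun (K (empirical x)) u := by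
  have : Measurable fun x => ∫ v : ℝ, Complex.exp (u * v * Complex.I)
      ∂(K.comap empirical (measurable_empirical n) x) :=
    (StronglyMeasurable.integral_kernel (Measurable.stronglyMeasurable (by fun_prop))).measurable
  simpa [charFun_apply_real] using this

lemma UnbiasedRuns.measurable_centeredCharFun_empirical (hK : UnbiasedRuns K ψ 𝓓) {n : ℕ+}
    (hemp : ∀ x : Fin n → 𝓧, empirical x ∈ 𝓓) (u : ℝ) :
    Measurable fun x : Fin n → 𝓧 => centeredCharFun (K (empirical x)) (ψ (empirical x)) u := by
  have e : ∀ x : Fin n → 𝓧, centeredCharFun (K (empirical x)) (ψ (empirical x)) u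
      = Complex.exp ((-(u * ψ (empirical x)) : ℝ) * Complex.I) * charFun (K (empirical x)) u := by
    intro x
    rw [charFun_eq_mul_centeredCharFun (ψ (empirical x)), ← mul_assoc, ← Complex.exp_add]
    simp
  simp_rw [e]
  have h1 := hK.measurable_comp_empirical hemp
  have h : Measurable fun a : ℝ => Complex.exp ((-(u * a) : ℝ) * Complex.I) := by fun_prop
  exact (h.comp (hK.measurable_comp_empirical hemp)).mul (measurable_charFun_empirical n u)

lemma measurable_average {R : ℕ+} : Measurable (average : (Fin R → ℝ) → ℝ) := by
  unfold average
  fun_prop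

lemma integral_resamplesKernel {n : ℕ+} {B : ℕ} (x : Fin n → 𝓧) {g : (Fin n → 𝓧) → ℝ}
    (hg : Measurable g) (t : Fin B → ℝ) :
    ∫ y, Complex.exp ((∑ b, t b * g (y b) : ℝ) * Complex.I) ∂(resamplesKernel 𝓧 n B x)
      = ∏ b, charFun ((resampleKernel 𝓧 n x).map g) (t b) := by
  have e : ∀ y : Fin B → Fin n → 𝓧, Complex.exp ((∑ b, t b * g (y b) : ℝ) * Complex.I)
      = ∏ b, Complex.exp ((t b : ℂ) * g (y b) * Complex.I) := fun y => by
    rw [← Complex.exp_sum]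
    congr 1
    rw [← Finset.sum_mul]
    push_cast
    ring
  simp_rw [e]
  change ∫ y : Fin B → Fin n → 𝓧, _ ∂(Measure.pi fun _ => resampleKernel 𝓧 n x) = _
  rw [integral_fintype_prod_eq_prod
    (f := fun (b : Fin B) (y : Fin n → 𝓧) => Complex.exp ((t b : ℂ) * g y * Complex.I))]
  refine Finset.prod_congr rfl fun b _ => ?_
  rw [charFun_apply_real, integral_map (by fun_prop) (by fun_prop)]

lemma measurable_charFun_resampleKernel_map {n : ℕ+} {g : (Fin n → 𝓧) → (Fin n → 𝓧) → ℝ}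
    (hg : Measurable (Function.uncurry g)) (t : ℝ) :
    Measurable fun x => charFun ((resampleKernel 𝓧 n x).map (g x)) t := by
  have hgx : ∀ x, Measurable (g x) := fun x => hg.comp measurable_prodMk_left
  have e : ∀ x, charFun ((resampleKernel 𝓧 n x).map (g x)) t
      = ∫ y, Complex.exp (t * Function.uncurry g (x, y) * Complex.I) ∂(resampleKernel 𝓧 n x) := by
    intro x
    rw [charFun_apply_real, integral_map (hgx x).aemeasurable (by fun_prop)]
    rfl
  simp_rw [e]
  exact (StronglyMeasurable.integral_kernel_prod_right'
    (f := fun z => Complex.exp (t * Function.uncurry g z * Complex.I))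
    (Measurable.stronglyMeasurable (by fun_prop))).measurable

variable [IsMarkovKernel K]

lemma integral_allRunsKernel (n : ℕ+) (B : ℕ) (R₀ R : ℕ+) (s₀ : ℝ) (s : Fin B → ℝ)
    (q : (Fin n → 𝓧) × (Fin B → Fin n → 𝓧)) :
    ∫ z, Complex.exp ((s₀ * average z.1 + ∑ b, s b * average (z.2 b) : ℝ) * Complex.I)
        ∂(allRunsKernel K n B R₀ R q)
      = charFun (K (empirical q.1)) (s₀ / (R₀ : ℝ)) ^ (R₀ : ℕ)
        * ∏ b, charFun (K (empirical (q.2 b))) (s b / (R : ℝ)) ^ (R : ℕ) := by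
  have e : ∀ z : (Fin R₀ → ℝ) × (Fin B → Fin R → ℝ),
      Complex.exp ((s₀ * average z.1 + ∑ b, s b * average (z.2 b) : ℝ) * Complex.I)
        = Complex.exp ((s₀ * average z.1 : ℝ) * Complex.I)
          * ∏ b, Complex.exp ((s b * average (z.2 b) : ℝ) * Complex.I) := fun z => by
    rw [← Complex.exp_sum, ← Complex.exp_add]
    congr 1
    rw [← Finset.sum_mul]
    push_cast
    ring
  simp_rw [e]
  have hk : allRunsKernel K n B R₀ R q
      = (Measure.pi fun _ : Fin R₀ => K (empirical q.1)).prod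
        (Measure.pi fun b : Fin B => Measure.pi fun _ : Fin R => K (empirical (q.2 b))) := by
    rw [allRunsKernel, Kernel.prod_apply]
    rfl
  rw [hk, integral_prod_mul (fun v : Fin R₀ → ℝ => Complex.exp ((s₀ * average v : ℝ) * Complex.I))
    (fun w : Fin B → Fin R → ℝ => ∏ b, Complex.exp ((s b * average (w b) : ℝ) * Complex.I)),
    integral_cexp_average_pi,
    integral_fintype_prod_eq_prod
      (f := fun (b : Fin B) (w : Fin R → ℝ) => Complex.exp ((s b * average w : ℝ) * Complex.I))]
  simp_rw [integral_cexp_average_pi]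

end Sampling

instance (𝓧 : Type*) [MeasurableSpace 𝓧] (n : ℕ+) (B : ℕ) :
    IsMarkovKernel (resamplesKernel 𝓧 n B) :=
  inferInstanceAs (IsMarkovKernel (prodKernel fun _ => resampleKernel 𝓧 n))

instance {𝓧 : Type*} [MeasurableSpace 𝓧] (K : Kernel (ProbabilityMeasure 𝓧) ℝ) [IsMarkovKernel K]
    (n : ℕ+) (B : ℕ) (R₀ R : ℕ+) : IsMarkovKernel (allRunsKernel K n B R₀ R) :=
  inferInstanceAs (IsMarkovKernel (_ ×ₖ prodKernel _))

/-- The scaled error `√n (ψ(P*ₙ) - ψ(P̂ₙ))` of the resample `y` of the sample `x`. -/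
noncomputable def resampleError {𝓧 : Type*} [MeasurableSpace 𝓧] (ψ : ProbabilityMeasure 𝓧 → ℝ)
    (n : ℕ+) (x y : Fin n → 𝓧) : ℝ :=
  √(n : ℝ) * (ψ (empirical y) - ψ (empirical x))

section ResampleError

variable {𝓧 α : Type*} [MeasurableSpace 𝓧] [MeasurableSpace α]
  {K : Kernel (ProbabilityMeasure 𝓧) ℝ} {ψ : ProbabilityMeasure 𝓧 → ℝ}
  {𝓓 : Set (ProbabilityMeasure 𝓧)}

lemma UnbiasedRuns.aemeasurable_resampleError (hK : UnbiasedRuns K ψ 𝓓) {n : ℕ+}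
    (hemp : ∀ x : Fin n → 𝓧, empirical x ∈ 𝓓) {ρ : Measure α} {x y : α → Fin n → 𝓧}
    (hx : AEMeasurable x ρ) (hy : AEMeasurable y ρ) :
    AEMeasurable (fun a => resampleError ψ n (x a) (y a)) ρ := by
  have h1 : AEMeasurable (fun a => ψ (empirical (x a))) ρ :=
    (hK.measurable_comp_empirical hemp).comp_aemeasurable hx
  have h2 : AEMeasurable (fun a => ψ (empirical (y a))) ρ :=
    (hK.measurable_comp_empirical hemp).comp_aemeasurable hy
  exact (h2.sub h1).const_mul _

lemma UnbiasedRuns.measurable_resampleError (hK : UnbiasedRuns K ψ 𝓓) {n : ℕ+}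
    (hemp : ∀ x : Fin n → 𝓧, empirical x ∈ 𝓓) {x y : α → Fin n → 𝓧}
    (hx : Measurable x) (hy : Measurable y) :
    Measurable fun a => resampleError ψ n (x a) (y a) := by
  have h1 : Measurable fun a => ψ (empirical (x a)) :=
    (hK.measurable_comp_empirical hemp).comp hx
  have h2 : Measurable fun a => ψ (empirical (y a)) :=
    (hK.measurable_comp_empirical hemp).comp hy
  exact (h2.sub h1).const_mul _

lemma measurable_cexp_ofReal_mul_I {f : α → ℝ} (hf : Measurable f) :
    Measurable fun a => Complex.exp ((f a : ℂ) * Complex.I) := by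
  fun_prop

lemma aestronglyMeasurable_cexp_ofReal_mul_I {ρ : Measure α} {f : α → ℝ} (hf : AEMeasurable f ρ) :
    AEStronglyMeasurable (fun a => Complex.exp ((f a : ℂ) * Complex.I)) ρ :=
  AEMeasurable.aestronglyMeasurable (by fun_prop)

end ResampleError

lemma charFun_div_pow_eq (ν : Measure ℝ) (a s : ℝ) (N : ℕ+) :
    charFun ν (s / (N : ℝ)) ^ (N : ℕ)
      = Complex.exp ((s * a : ℝ) * Complex.I) * centeredCharFun ν a (s / (N : ℝ)) ^ (N : ℕ) := by
  rw [charFun_eq_mul_centeredCharFun a, mul_pow, ← Complex.exp_nat_mul]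
  congr 2
  have : (N : ℂ) ≠ 0 := by exact_mod_cast N.ne_zero
  push_cast
  field_simp

lemma integral_allRunsKernel_eq_mul_centeredCharFun {𝓧 : Type*} [MeasurableSpace 𝓧]
    {K : Kernel (ProbabilityMeasure 𝓧) ℝ} [IsMarkovKernel K] (ψ : ProbabilityMeasure 𝓧 → ℝ)
    {n : ℕ+} {B : ℕ} {R₀ R : ℕ+} (s₀ : ℝ) (s : Fin B → ℝ)
    (q : (Fin n → 𝓧) × (Fin B → Fin n → 𝓧)) :
    ∫ z, Complex.exp ((s₀ * average z.1 + ∑ b, s b * average (z.2 b) : ℝ) * Complex.I)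
        ∂(allRunsKernel K n B R₀ R q)
      = Complex.exp ((s₀ * ψ (empirical q.1) + ∑ b, s b * ψ (empirical (q.2 b)) : ℝ) * Complex.I)
        * (centeredCharFun (K (empirical q.1)) (ψ (empirical q.1)) (s₀ / (R₀ : ℝ)) ^ (R₀ : ℕ)
          * ∏ b, centeredCharFun (K (empirical (q.2 b))) (ψ (empirical (q.2 b))) (s b / (R : ℝ))
              ^ (R : ℕ)) := by
  rw [integral_allRunsKernel, charFun_div_pow_eq _ (ψ (empirical q.1))]
  simp_rw [fun b => charFun_div_pow_eq (K (empirical (q.2 b))) (ψ (empirical (q.2 b))) (s b) R]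
  rw [Finset.prod_mul_distrib, ← Complex.exp_sum, mul_mul_mul_comm, ← Complex.exp_add]
  congr 2
  push_cast
  rw [← Finset.sum_mul]
  ring

lemma norm_prod_le_one {ι : Type*} [Fintype ι] {z : ι → ℂ} (hz : ∀ b, ‖z b‖ ≤ 1) :
    ‖∏ b, z b‖ ≤ 1 := by
  rw [norm_prod]
  exact Finset.prod_le_one (fun _ _ => norm_nonneg _) fun b _ => hz b

section Factors

variable {Ω 𝓧 : Type*} [MeasurableSpace Ω] [MeasurableSpace 𝓧]

/-- The characteristic function at `(√n s₀, √n s)` of the centered averages of computation runs,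
given the sample `x` and the resamples `y`. -/
noncomputable def runsCharFun (K : Kernel (ProbabilityMeasure 𝓧) ℝ)
    (ψ : ProbabilityMeasure 𝓧 → ℝ) {n : ℕ+} {B : ℕ} (R₀ R : ℕ+) (s₀ : ℝ) (s : Fin B → ℝ)
    (x : Fin n → 𝓧) (y : Fin B → Fin n → 𝓧) : ℂ :=
  centeredCharFun (K (empirical x)) (ψ (empirical x)) (s₀ * √(n : ℝ) / (R₀ : ℝ)) ^ (R₀ : ℕ)
    * ∏ b, centeredCharFun (K (empirical (y b))) (ψ (empirical (y b)))
        (s b * √(n : ℝ) / (R : ℝ)) ^ (R : ℕ)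

/-- The characteristic function of the scaled resample error, given the sample `x`. -/
noncomputable def resampleCharFun (ψ : ProbabilityMeasure 𝓧 → ℝ) (n : ℕ+) (x : Fin n → 𝓧)
    (t : ℝ) : ℂ :=
  charFun ((resampleKernel 𝓧 n x).map (resampleError ψ n x)) t

variable {μ : Measure Ω} {P : ProbabilityMeasure 𝓧}
  {K : Kernel (ProbabilityMeasure 𝓧) ℝ} {ψ : ProbabilityMeasure 𝓧 → ℝ}
  {𝓓 : Set (ProbabilityMeasure 𝓧)} {B : ℕ} {R₀ R : ℕ+ → ℕ+} {X : ℕ → Ω → 𝓧}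
  {Y : (n : ℕ+) → Ω → Fin B → Fin n → 𝓧} {V₀ : (n : ℕ+) → Ω → Fin (R₀ n) → ℝ}
  {V : (n : ℕ+) → Ω → Fin B → Fin (R n) → ℝ}

lemma norm_centeredCharFun_pow_le_one [IsMarkovKernel K] (Q : ProbabilityMeasure 𝓧) (a u : ℝ) (N : ℕ) :
    ‖centeredCharFun (K Q) a u ^ N‖ ≤ 1 := by
  rw [norm_pow]
  exact pow_le_one₀ (norm_nonneg _) (norm_centeredCharFun_le_one _ _)

lemma norm_runsCharFun_le_one [IsMarkovKernel K] {n : ℕ+} (r₀ r : ℕ+) (s₀ : ℝ) (s : Fin B → ℝ)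
    (x : Fin n → 𝓧) (y : Fin B → Fin n → 𝓧) : ‖runsCharFun K ψ r₀ r s₀ s x y‖ ≤ 1 := by
  rw [runsCharFun, norm_mul]
  exact mul_le_one₀ (norm_centeredCharFun_pow_le_one _ _ _ _) (norm_nonneg _)
    (norm_prod_le_one fun b => norm_centeredCharFun_pow_le_one _ _ _ _)

lemma UnbiasedRuns.aemeasurable_runsCharFun (hK : UnbiasedRuns K ψ 𝓓) {n : ℕ+}
    (hemp : ∀ x : Fin n → 𝓧, empirical x ∈ 𝓓) (r₀ r : ℕ+) (s₀ : ℝ) (s : Fin B → ℝ)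
    {x : Ω → Fin n → 𝓧} {y : Ω → Fin B → Fin n → 𝓧} (hx : AEMeasurable x μ)
    (hy : AEMeasurable y μ) :
    AEMeasurable (fun ω => runsCharFun K ψ r₀ r s₀ s (x ω) (y ω)) μ := by
  refine AEMeasurable.mul ?_ (Finset.aemeasurable_fun_prod _ fun b _ => ?_)
  · exact ((hK.measurable_centeredCharFun_empirical hemp _).comp_aemeasurable hx).pow_const _
  · exact ((hK.measurable_centeredCharFun_empirical hemp _).comp_aemeasurable
      ((measurable_pi_apply b).comp_aemeasurable hy)).pow_const _

lemma UnbiasedRuns.norm_resampleCharFun_le_one (hK : UnbiasedRuns K ψ 𝓓) {n : ℕ+}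
    (hemp : ∀ x : Fin n → 𝓧, empirical x ∈ 𝓓) (x : Fin n → 𝓧) (t : ℝ) :
    ‖resampleCharFun ψ n x t‖ ≤ 1 := by
  have := Measure.isProbabilityMeasure_map (μ := resampleKernel 𝓧 n x)
    (hK.measurable_resampleError hemp measurable_const measurable_id).aemeasurable (f := resampleError ψ n x)
  exact norm_charFun_le_one _

lemma NestedSampling.integral_cexp_runs [IsProbabilityMeasure μ] [IsMarkovKernel K]
    (hs : NestedSampling μ P K B R₀ R X Y V₀ V) (n : ℕ+)
    (t₀ : ℝ) (t : Fin B → ℝ) :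
    ∫ ω, Complex.exp ((t₀ * (√(n : ℝ) * (average (V₀ n ω) - ψ P))
        + ∑ b, t b * (√(n : ℝ) * (average (V n ω b) - average (V₀ n ω))) : ℝ) * Complex.I) ∂μ
      = ∫ ω, Complex.exp ((t₀ * (√(n : ℝ) * (ψ (empirical (sample X n ω)) - ψ P))
          + ∑ b, t b * resampleError ψ n (sample X n ω) (Y n ω b) : ℝ) * Complex.I)
        * runsCharFun K ψ (R₀ n) (R n) (t₀ - ∑ b, t b) t (sample X n ω) (Y n ω) ∂μ := by
  set s₀ : ℝ := t₀ - ∑ b, t b with hs₀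
  set r : ℝ := √(n : ℝ) with hr
  have hf : Measurable fun z :
      ((Fin n → 𝓧) × (Fin B → Fin n → 𝓧)) × ((Fin (R₀ n) → ℝ) × (Fin B → Fin (R n) → ℝ)) =>
      Complex.exp ((s₀ * r * average z.2.1
        + ∑ b : Fin B, t b * r * average (z.2.2 b) : ℝ) * Complex.I) := by
    have h1 := measurable_average (R := R₀ n)
    have h2 := measurable_average (R := R n)
    fun_prop
  have hL : ∀ ω, Complex.exp ((t₀ * (r * (average (V₀ n ω) - ψ P))
        + ∑ b, t b * (r * (average (V n ω b) - average (V₀ n ω))) : ℝ) * Complex.I)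
      = Complex.exp ((-(t₀ * r * ψ P) : ℝ) * Complex.I)
        * Complex.exp ((s₀ * r * average (V₀ n ω)
          + ∑ b : Fin B, t b * r * average (V n ω b) : ℝ) * Complex.I) := by
    intro ω
    rw [← Complex.exp_add, ← add_mul, ← Complex.ofReal_add]
    congr 3
    simp only [hs₀, mul_sub, sub_mul, Finset.sum_sub_distrib, Finset.sum_mul, mul_assoc]
    ring
  simp_rw [hL]
  rw [integral_const_mul, (hs.runs n).integral_eq hf fun z => (Complex.norm_exp_ofReal_mul_I _).le,
    ← integral_const_mul]
  congr with ω
  rw [integral_allRunsKernel_eq_mul_centeredCharFun ψ (s₀ * r) (fun b => t b * r)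
    (sample X n ω, Y n ω), runsCharFun, ← mul_assoc, ← Complex.exp_add, ← add_mul,
    ← Complex.ofReal_add]
  congr 4
  simp only [hs₀, resampleError, mul_sub, sub_mul, Finset.sum_sub_distrib, Finset.sum_mul,
    mul_assoc]
  ring

lemma NestedSampling.integral_cexp_resamples [IsProbabilityMeasure μ] [IsMarkovKernel K]
    (hs : NestedSampling μ P K B R₀ R X Y V₀ V)
    (hK : UnbiasedRuns K ψ 𝓓) {n : ℕ+} (hemp : ∀ x : Fin n → 𝓧, empirical x ∈ 𝓓)
    (t₀ : ℝ) (t : Fin B → ℝ) :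
    ∫ ω, Complex.exp ((t₀ * (√(n : ℝ) * (ψ (empirical (sample X n ω)) - ψ P))
        + ∑ b, t b * resampleError ψ n (sample X n ω) (Y n ω b) : ℝ) * Complex.I) ∂μ
      = ∫ ω, Complex.exp ((t₀ * (√(n : ℝ) * (ψ (empirical (sample X n ω)) - ψ P)) : ℝ)
          * Complex.I) * ∏ b, resampleCharFun ψ n (sample X n ω) (t b) ∂μ := by
  have hf : Measurable fun z : (Fin n → 𝓧) × (Fin B → Fin n → 𝓧) =>
      Complex.exp ((t₀ * (√(n : ℝ) * (ψ (empirical z.1) - ψ P))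
        + ∑ b, t b * resampleError ψ n z.1 (z.2 b) : ℝ) * Complex.I) := by
    have h1 : Measurable fun z : (Fin n → 𝓧) × (Fin B → Fin n → 𝓧) => ψ (empirical z.1) :=
      (hK.measurable_comp_empirical hemp).comp measurable_fst
    have h2 : ∀ b, Measurable fun z : (Fin n → 𝓧) × (Fin B → Fin n → 𝓧) =>
        resampleError ψ n z.1 (z.2 b) := fun b =>
      hK.measurable_resampleError hemp measurable_fst
        ((measurable_pi_apply b).comp measurable_snd)
    exact measurable_cexp_ofReal_mul_I ((((h1.sub_const _).const_mul _).const_mul _).add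
      (Finset.measurable_fun_sum _ fun b _ => (h2 b).const_mul _))
  refine ((hs.resamples n).integral_eq hf fun z => (Complex.norm_exp_ofReal_mul_I _).le).trans ?_
  congr with ω
  simp_rw [Complex.ofReal_add, add_mul, Complex.exp_add]
  rw [integral_const_mul,
    integral_resamplesKernel (g := resampleError ψ n (sample X n ω)) _
      (hK.measurable_resampleError hemp measurable_const measurable_id)]
  rfl

lemma MomentConsistent.tendsto_runsCharFun [IsMarkovKernel K] {τ : ℝ} (h : MomentConsistent μ P K ψ X Y τ)
    (hK : UnbiasedRuns K ψ 𝓓) (hemp : ∀ (n : ℕ+) (x : Fin n → 𝓧), empirical x ∈ 𝓓)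
    {p₀ p : ℝ} (hp₀ : 0 < p₀) (hp : 0 < p)
    (hR₀ : Tendsto (fun n : ℕ+ => (R₀ n : ℝ) / (n : ℝ)) atTop (𝓝 p₀))
    (hR : Tendsto (fun n : ℕ+ => (R n : ℝ) / (n : ℝ)) atTop (𝓝 p)) (s₀ : ℝ) (s : Fin B → ℝ) :
    Tendsto (fun q : ℕ+ × Ω =>
        runsCharFun K ψ (R₀ q.1) (R q.1) s₀ s (sample X q.1 q.2) (Y q.1 q.2))
      (inProbability μ atTop) (𝓝 (charFun (gaussianReal 0 1) (τ / √p₀ * s₀)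
        * ∏ b, charFun (gaussianReal 0 1) (τ / √p * s b))) := by
  have hN : Tendsto (fun q : ℕ+ × Ω => (q.1 : ℝ)) (inProbability μ atTop) atTop :=
    (tendsto_natCast_atTop_atTop.comp tendsto_PNat_val_atTop_atTop).comp
      (tendsto_fst_inProbability μ atTop)
  have hτ := h.variance_eq
  have hκ := h.thirdMoment_lt_top.ne
  refine Tendsto.mul ?_ (tendsto_finsetProd _ fun b _ => ?_)
  · have h2 := h.variance_data.tendsto_inProbability_ennreal (by simp [hτ])
    have h3 := h.thirdMoment_data.tendsto_inProbability_ennreal hκ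
    rw [hτ] at h2
    exact tendsto_centeredCharFun_pow
      (ν := fun q : ℕ+ × Ω => K (empirical (sample X q.1 q.2)))
      (m := fun q => ψ (empirical (sample X q.1 q.2))) (N := Prod.fst) (R := fun q => R₀ q.1)
      (fun q => (hK _ (hemp _ _)).1) (fun q => (hK _ (hemp _ _)).2) hκ h2 h3 hp₀ hN
      (hR₀.comp (tendsto_fst_inProbability μ atTop)) s₀
  · have h2 := (h.variance_resample b).tendsto_inProbability_ennreal (by simp [hτ])
    have h3 := (h.thirdMoment_resample b).tendsto_inProbability_ennreal hκ
    rw [hτ] at h2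
    exact tendsto_centeredCharFun_pow
      (ν := fun q : ℕ+ × Ω => K (empirical (Y q.1 q.2 b)))
      (m := fun q => ψ (empirical (Y q.1 q.2 b))) (N := Prod.fst) (R := fun q => R q.1)
      (fun q => (hK _ (hemp _ _)).1) (fun q => (hK _ (hemp _ _)).2) hκ h2 h3 hp hN
      (hR.comp (tendsto_fst_inProbability μ atTop)) (s b)

lemma charFun_gaussianReal_zero_sq (σ u : ℝ) :
    charFun (gaussianReal 0 (σ ^ 2).toNNReal) u = charFun (gaussianReal 0 1) (σ * u) := by
  rw [charFun_gaussianReal, charFun_gaussianReal, Real.coe_toNNReal _ (sq_nonneg σ)]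
  congr 1
  push_cast
  ring

lemma BootstrapValid.tendsto_resampleCharFun [IsProbabilityMeasure μ] {σ : ℝ} (h : BootstrapValid μ P ψ X σ)
    (hK : UnbiasedRuns K ψ 𝓓) (hemp : ∀ (n : ℕ+) (x : Fin n → 𝓧), empirical x ∈ 𝓓) (t : ℝ) :
    Tendsto (fun q : ℕ+ × Ω => resampleCharFun ψ q.1 (sample X q.1 q.2) t)
      (inProbability μ atTop) (𝓝 (charFun (gaussianReal 0 1) (σ * t))) := by
  have hg : ∀ n x, Measurable (resampleError ψ n x) := fun n x =>
    hK.measurable_resampleError (hemp n) measurable_const measurable_id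
  rw [← charFun_gaussianReal_zero_sq]
  refine tendsto_charFun_of_tendsto_real_Iic
    (ν := fun q : ℕ+ × Ω => ⟨(resampleKernel 𝓧 q.1 (sample X q.1 q.2)).map
      (resampleError ψ q.1 (sample X q.1 q.2)),
      Measure.isProbabilityMeasure_map (hg _ _).aemeasurable⟩)
    (γ := ⟨gaussianReal 0 (σ ^ 2).toNNReal, inferInstance⟩) (fun x => ?_) t
  refine (h.resample x).tendsto_inProbability.congr fun q => ?_
  rw [ProbabilityMeasure.coe_mk, map_measureReal_apply (hg _ _) measurableSet_Iic]
  rfl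

/-- The characteristic function of the vector of nested bootstrap errors converges. -/
lemma NestedSampling.tendsto_integral_cexp [IsProbabilityMeasure μ] [IsMarkovKernel K]
    (hs : NestedSampling μ P K B R₀ R X Y V₀ V)
    (hK : UnbiasedRuns K ψ 𝓓) (hemp : ∀ (n : ℕ+) (x : Fin n → 𝓧), empirical x ∈ 𝓓)
    {σ τ : ℝ} (hboot : BootstrapValid μ P ψ X σ) (hmoment : MomentConsistent μ P K ψ X Y τ)
    {p₀ p : ℝ} (hp₀ : 0 < p₀) (hp : 0 < p)
    (hR₀ : Tendsto (fun n : ℕ+ => (R₀ n : ℝ) / (n : ℝ)) atTop (𝓝 p₀))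
    (hR : Tendsto (fun n : ℕ+ => (R n : ℝ) / (n : ℝ)) atTop (𝓝 p)) (t₀ : ℝ) (t : Fin B → ℝ) :
    Tendsto (fun n : ℕ+ => ∫ ω, Complex.exp ((t₀ * (√(n : ℝ) * (average (V₀ n ω) - ψ P))
        + ∑ b, t b * (√(n : ℝ) * (average (V n ω b) - average (V₀ n ω))) : ℝ) * Complex.I) ∂μ)
      atTop (𝓝 ((charFun (gaussianReal 0 1) (σ * t₀)
          * ∏ b, charFun (gaussianReal 0 1) (σ * t b))
        * (charFun (gaussianReal 0 1) (τ / √p₀ * (t₀ - ∑ b, t b))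
          * ∏ b, charFun (gaussianReal 0 1) (τ / √p * t b)))) := by
  have hX : ∀ n, AEMeasurable (sample X n) μ := fun n => (hs.resamples n).aemeasurable_fst
  have hY : ∀ n, AEMeasurable (Y n) μ := fun n => (hs.resamples n).aemeasurable_snd
  have hψX : ∀ n, AEMeasurable (fun ω => ψ (empirical (sample X n ω))) μ := fun n =>
    (hK.measurable_comp_empirical (hemp n)).comp_aemeasurable (hX n)
  have herr : ∀ n b, AEMeasurable (fun ω => resampleError ψ n (sample X n ω) (Y n ω b)) μ :=
    fun n b => hK.aemeasurable_resampleError (hemp n) (hX n)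
      ((measurable_pi_apply b).comp_aemeasurable (hY n))
  have hγ : ∀ u : ℝ, ‖charFun (gaussianReal 0 1) u‖ ≤ 1 := fun u => norm_charFun_le_one u
  have horiginal := hboot.original.tendsto_integral_cexp t₀
  rw [charFun_gaussianReal_zero_sq] at horiginal
  have hresample := tendsto_integral_mul_sub_of_inProbability (μ := μ) (l := atTop)
    (Φ := fun n ω => ∏ b, resampleCharFun ψ n (sample X n ω) (t b))
    (G := fun (n : ℕ+) ω => Complex.exp ((t₀ * (√(n : ℝ) * (ψ (empirical (sample X n ω)) - ψ P)) : ℝ)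
      * Complex.I))
    (fun n => (Finset.aemeasurable_fun_prod _ fun b _ =>
      (measurable_charFun_resampleKernel_map
        (hK.measurable_resampleError (hemp n) measurable_fst measurable_snd)
        (t b)).comp_aemeasurable (hX n)).aestronglyMeasurable)
    (fun n => aestronglyMeasurable_cexp_ofReal_mul_I
      ((((hψX n).sub_const _).const_mul _).const_mul _))
    (fun n ω => norm_prod_le_one fun b => hK.norm_resampleCharFun_le_one (hemp n) _ _)
    (fun n ω => (Complex.norm_exp_ofReal_mul_I _).le) (norm_prod_le_one fun b => hγ (σ * t b))
    (tendsto_finsetProd _ fun b _ => hboot.tendsto_resampleCharFun hK hemp (t b))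
  have hdata := hresample.add (horiginal.const_mul (∏ b, charFun (gaussianReal 0 1) (σ * t b)))
  simp only [zero_add, sub_add_cancel] at hdata
  simp_rw [← hs.integral_cexp_resamples hK (hemp _)] at hdata
  have hruns := tendsto_integral_mul_sub_of_inProbability (μ := μ) (l := atTop)
    (Φ := fun n ω => runsCharFun K ψ (R₀ n) (R n) (t₀ - ∑ b, t b) t (sample X n ω) (Y n ω))
    (G := fun (n : ℕ+) ω => Complex.exp ((t₀ * (√(n : ℝ) * (ψ (empirical (sample X n ω)) - ψ P))
        + ∑ b, t b * resampleError ψ n (sample X n ω) (Y n ω b) : ℝ) * Complex.I))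
    (fun n => (hK.aemeasurable_runsCharFun (hemp n) _ _ _ _ (hX n) (hY n)).aestronglyMeasurable)
    (fun n => aestronglyMeasurable_cexp_ofReal_mul_I
      (((((hψX n).sub_const _).const_mul _).const_mul _).add
        (Finset.aemeasurable_fun_sum _ fun b _ => (herr n b).const_mul _)))
    (fun n ω => norm_runsCharFun_le_one _ _ _ _ _ _)
    (fun n ω => (Complex.norm_exp_ofReal_mul_I _).le)
    (by
      rw [norm_mul]
      exact mul_le_one₀ (hγ _) (norm_nonneg _) (norm_prod_le_one fun b => hγ _))
    (hmoment.tendsto_runsCharFun hK hemp hp₀ hp hR₀ hR _ t)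
  have hall := hruns.add (hdata.const_mul
    (charFun (gaussianReal 0 1) (τ / √p₀ * (t₀ - ∑ b, t b))
      * ∏ b, charFun (gaussianReal 0 1) (τ / √p * t b)))
  simp only [zero_add, sub_add_cancel] at hall
  simp_rw [← hs.integral_cexp_runs] at hall
  convert! hall using 2
  ring

end Factors

lemma integral_cexp_gaussian_combination {Ω' ι : Type*} [MeasurableSpace Ω'] [Fintype ι]
    {μ' : Measure Ω'} [IsProbabilityMeasure μ'] {Z W : ι → Ω' → ℝ}
    (hZ : ∀ b, HasLaw (Z b) (gaussianReal 0 1) μ') (hW : ∀ b, HasLaw (W b) (gaussianReal 0 1) μ')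
    (hZW : iIndepFun (Sum.elim Z W) μ') (c d : ι → ℝ) :
    ∫ ω', Complex.exp ((∑ j, c j * Z j ω' + ∑ j, d j * W j ω' : ℝ) * Complex.I) ∂μ'
      = (∏ j, charFun (gaussianReal 0 1) (c j)) * ∏ j, charFun (gaussianReal 0 1) (d j) := by
  set U := Sum.elim Z W
  set a := Sum.elim c d
  have hU : ∀ i, HasLaw (U i) (gaussianReal 0 1) μ' := by
    rintro (j | j)
    · exact hZ j
    · exact hW j
  have hUm : ∀ i, AEMeasurable (U i) μ' := fun i => (hU i).aemeasurable
  have hind : iIndepFun (fun i ω => a i * U i ω) μ' :=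
    hZW.comp (fun i x => a i * x) fun i => by fun_prop
  have h := congrFun (hind.charFun_map_fun_sum_eq_prod fun i => (hUm i).const_mul _) 1
  rw [Finset.prod_apply] at h
  simp_rw [charFun_map_mul_comp (hUm _), (hU _).map_eq, mul_one] at h
  rw [Fintype.prod_sum_type, charFun_apply_real, integral_map
    (Finset.aemeasurable_fun_sum _ fun i _ => (hUm i).const_mul _) (by fun_prop)] at h
  simp only [Fintype.sum_sum_type, Complex.ofReal_one, one_mul] at h
  exact h

end CheapBootstrap

theorem theorem3 {Ω Ω' 𝓧 : Type*} [MeasurableSpace Ω] [MeasurableSpace Ω'] [MeasurableSpace 𝓧]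
    (μ : Measure Ω) [IsProbabilityMeasure μ] (μ' : Measure Ω') [IsProbabilityMeasure μ']
    -- the data distribution, a class of distributions, the functional, the law of a run
    (P : ProbabilityMeasure 𝓧) (𝓓 : Set (ProbabilityMeasure 𝓧)) (hP : P ∈ 𝓓)
    (hemp : ∀ (n : ℕ+) (x : Fin n → 𝓧), empirical x ∈ 𝓓)
    (ψ : ProbabilityMeasure 𝓧 → ℝ)
    (K : Kernel (ProbabilityMeasure 𝓧) ℝ) [IsMarkovKernel K] (hK : UnbiasedRuns K ψ 𝓓)
    -- data, resamples and computation runs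
    (B : ℕ) (R₀ R : ℕ+ → ℕ+)
    (X : ℕ → Ω → 𝓧) (Y : (n : ℕ+) → Ω → Fin B → Fin n → 𝓧)
    (V₀ : (n : ℕ+) → Ω → Fin (R₀ n) → ℝ) (V : (n : ℕ+) → Ω → Fin B → Fin (R n) → ℝ)
    (hsampling : NestedSampling μ P K B R₀ R X Y V₀ V)
    -- the two assumptions
    (σ τ : ℝ) (hboot : BootstrapValid μ P ψ X σ) (hmoment : MomentConsistent μ P K ψ X Y τ)
    -- computation sizes
    (p₀ p : ℝ) (hp₀ : 0 < p₀) (hp₀' : p₀ < 1) (hp : 0 < p) (hp' : p < 1)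
    (hR₀ : Tendsto (fun n : ℕ+ => (R₀ n : ℝ) / (n : ℝ)) atTop (𝓝 p₀))
    (hR : Tendsto (fun n : ℕ+ => (R n : ℝ) / (n : ℝ)) atTop (𝓝 p))
    -- independent standard normal variables
    (Z W : Fin (B + 1) → Ω' → ℝ) (hZ : ∀ b, HasLaw (Z b) (gaussianReal 0 1) μ')
    (hW : ∀ b, HasLaw (W b) (gaussianReal 0 1) μ') (hZW : iIndepFun (Sum.elim Z W) μ') :
    TendstoInDistribution
      (fun (n : ℕ+) ω => (Fin.cons
        (√(n : ℝ) * (average (V₀ n ω) - ψ P))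
        (fun b : Fin B => √(n : ℝ) * (average (V n ω b) - average (V₀ n ω))) :
          Fin (B + 1) → ℝ))
      atTop
      (fun ω' => (Fin.cons
        (σ * Z 0 ω' + τ / √p₀ * W 0 ω')
        (fun b : Fin B => σ * Z b.succ ω' + τ / √p * W b.succ ω' - τ / √p₀ * W 0 ω') :
          Fin (B + 1) → ℝ))
      (fun _ => μ) μ' := by
  have hZm : ∀ b, AEMeasurable (Z b) μ' := fun b => (hZ b).aemeasurable
  have hWm : ∀ b, AEMeasurable (W b) μ' := fun b => (hW b).aemeasurable
  have hV : ∀ n, AEMeasurable (fun ω => (V₀ n ω, V n ω)) μ := fun n =>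
    (hsampling.runs n).aemeasurable_snd
  have hV₀a : ∀ n, AEMeasurable (fun ω => average (V₀ n ω)) μ := fun n =>
    measurable_average.comp_aemeasurable (hV n).fst
  have hVa : ∀ n b, AEMeasurable (fun ω => average (V n ω b)) μ := fun n b =>
    measurable_average.comp_aemeasurable
      ((measurable_pi_apply b).comp_aemeasurable (hV n).snd)
  refine tendstoInDistribution_of_tendsto_charFun ?_ ?_ ?_
  · intro n
    refine aemeasurable_pi_iff.2 (Fin.cases ?_ fun b => ?_)
    · simpa only [Fin.cons_zero] using ((hV₀a n).sub_const _).const_mul _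
    · simp only [Fin.cons_succ]
      exact ((hVa n b).sub (hV₀a n)).const_mul _
  · refine aemeasurable_pi_iff.2 (Fin.cases ?_ fun b => ?_)
    · simp only [Fin.cons_zero]; fun_prop
    · simp only [Fin.cons_succ]; fun_prop
  intro t
  simp_rw [Fin.sum_univ_succ, Fin.cons_zero, Fin.cons_succ]
  have hlim := hsampling.tendsto_integral_cexp hK hemp hboot hmoment hp₀ hp hR₀ hR (t 0)
    fun b => t b.succ
  have hgauss := integral_cexp_gaussian_combination hZ hW hZW (fun j => σ * t j)
    (Fin.cons (τ / √p₀ * (t 0 - ∑ b : Fin B, t b.succ)) fun b : Fin B => τ / √p * t b.succ)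
  simp_rw [Fin.prod_univ_succ, Fin.sum_univ_succ, Fin.cons_zero, Fin.cons_succ] at hgauss
  rw [← hgauss] at hlim
  convert! hlim using 6 with ω'
  congr 1
  simp only [div_eq_mul_inv, mul_sub, mul_add, Finset.sum_sub_distrib, Finset.sum_add_distrib,
    Finset.mul_sum, mul_left_comm, mul_comm]
  ring
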